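/- Let $\mathcal M$ and $\mathcal M'$ be ergodic (irreducible and aperiodic), not necessarily reversible, discrete-time Markov chains on a finite state space $\Omega$, with transition matrices $P$ and $P'$ and with the same stationary distribution $\pi$. Notation. Let $\|\theta_1-\theta_2\|=\frac12\sum_{i\in\Omega}|\theta_1(i)-\theta_2(i)|$. For $x\in\Omega$ and $\varepsilon>0$ let $$\tau_x(\mathcal M,\varepsilon)=\min\{t\in\mathbb N,\ t>0:\ \|P^{t'}(x,\cdot)-\pi\|\le\varepsilon\text{ for all integers }t'\ge t\},\qquad \tau(\mathcal M,\varepsilon)=\max_{x}\tau_x(\mathcal M,\varepsilon).$$ The continuization $\widetilde{\mathcal M}$ is the continuous-time chain with transition rate matrix $P-I$, and $$\tau_x(\widetilde{\mathcal M},\varepsilon)=\inf\{t>0:\ \|\exp(t'(P-I))(x,\cdot)-\pi\|\le\varepsilon\text{ for all real }t'\ge t\},\qquad \tau(\widetilde{\mathcal M},\varepsilon)=\max_{x}\tau_x(\widetilde{\mathcal M},\varepsilon).$$ Let $E^*(\mathcal M)=\{(x,y)\in\Omega^2: P(x,y)>0\}$ (with $x=y$ allowed), and similarly $E^*(\mathcal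 M')$. For $(x,y)\in E^*(\mathcal M')$ let $\mathcal P_{x,y}$ be the set of paths $\gamma=(x=x_0,x_1,\dots,x_k=y)$, $k\ge 0$, such that every $(x_i,x_{i+1})$ lies in $E^*(\mathcal M)$ and every $(z,w)\in E^*(\mathcal M)$ appears at most twice on $\gamma$; write $|\gamma|=k$, let $r((z,w),\gamma)$ be the number of times that $(z,w)$ appears on $\gamma$, and let $\mathcal P=\bigcup_{(x,y)\in E^*(\mathcal M')}\mathcal P_{x,y}$. An $(\mathcal M,\mathcal M')$-flow is a function $f:\mathcal P\to[0,1]$ with $\sum_{\gamma\in\mathcal P_{x,y}}f(\gamma)=\pi(x)P'(x,y)$ for every $(x,y)\in E^*(\mathcal M')$. Its congestion is $$A(f)=\max_{(z,w)\in E^*(\mathcal M)}\ \frac1{\pi(z)P(z,w)}\sum_{\gamma\in\mathcal P:\,(z,w)\in\gamma}r((z,w),\gamma)\,|\gamma|\,f(\gamma).$$ Theorem. Let $f$ be an $(\mathcal M,\mathcal M')$-flow, let $x\in\Omega$, and let $\varepsilon>0$ satisfy $\varepsilon^2\pi(x)\le 1$ (for example, $0<\varepsilon\le 1$). Then the mixing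 times below are finite, and $$\tau_x(\widetilde{\mathcal M},\varepsilon)\le 4A(f)\,\frac{\tau\left(\widetilde{\mathcal M'},\frac1{2e}\right)^2}{\left(\frac12-\frac1{2e}\right)^2}\,\ln\left(\frac1{\varepsilon^2\pi(x)}\right)$$ and $$\tau_x(\widetilde{\mathcal M},\varepsilon)\le 4A(f)\,\frac{\tau\left(\mathcal M',\frac1{2e}\right)^2}{\left(\frac12-\frac1{2e}\right)^2}\,\ln\left(\frac1{\varepsilon^2\pi(x)}\right).$$ -/

import Mathlib

noncomputable section

namespace ChainComparison

variable {Ω : Type*} [Fintype Ω] [DecidableEq Ω]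

/-- `P` is the transition matrix of an ergodic Markov chain on the finite state space `Ω`: it is
row-stochastic, connected (every state can be reached from every state) and aperiodic (for every
state `x`, the greatest common divisor of the times at which the chain can return to `x` is `1`). -/
structure IsErgodic (P : Matrix Ω Ω ℝ) : Prop where
  stochastic : P ∈ Matrix.rowStochastic ℝ Ω
  connected : P.IsIrreducible
  aperiodic : ∀ (x : Ω) (d : ℕ), (∀ n : ℕ, 0 < n → 0 < (P ^ n) x x → d ∣ n) → d = 1

/-- `π` is a stationary distribution of `P`: a probability vector with `π P = π`. -/
structure IsStationary (P : Matrix Ω Ω ℝ) (π : Ω → ℝ) : Prop where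
  mem_stdSimplex : π ∈ stdSimplex ℝ Ω
  vecMul_eq : Matrix.vecMul π P = π

/-- The variation distance `(1 / 2) ∑ |μ i - ν i|`. -/
def variationDist (μ ν : Ω → ℝ) : ℝ := (1 / 2) * ∑ i, |μ i - ν i|

/-! ### Mixing times -/

/-- The distribution at time `t` of the discrete-time chain started in state `x`. -/
def discreteLaw (P : Matrix Ω Ω ℝ) (x : Ω) (t : ℕ) : Ω → ℝ :=
  Matrix.vecMul (Pi.single x 1) (P ^ t)

/-- The distribution at time `t` of the continuization, i.e. of the continuous-time chain with
transition rate matrix `Q = P - I`, started in state `x`. -/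
def continuousLaw (P : Matrix Ω Ω ℝ) (x : Ω) (t : ℝ) : Ω → ℝ :=
  Matrix.vecMul (Pi.single x 1) (NormedSpace.exp (t • (P - 1)))

/-- The times `t > 0` from which on the discrete-time chain started in `x` stays within variation
distance `ε` of `π`. -/
def discreteMixingSet (P : Matrix Ω Ω ℝ) (π : Ω → ℝ) (x : Ω) (ε : ℝ) : Set ℕ :=
  {t | 0 < t ∧ ∀ t' : ℕ, t ≤ t' → variationDist (discreteLaw P x t') π ≤ ε}

/-- The times `t > 0` from which on the continuization started in `x` stays within variation
distance `ε` of `π`. -/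
def continuousMixingSet (P : Matrix Ω Ω ℝ) (π : Ω → ℝ) (x : Ω) (ε : ℝ) : Set ℝ :=
  {t | 0 < t ∧ ∀ t' : ℝ, t ≤ t' → variationDist (continuousLaw P x t') π ≤ ε}

/-- The mixing time `τ_x` of the discrete-time chain from `x`. -/
def discreteMixingTimeFrom (P : Matrix Ω Ω ℝ) (π : Ω → ℝ) (x : Ω) (ε : ℝ) : ℕ :=
  sInf (discreteMixingSet P π x ε)

/-- The mixing time `τ_x` of the continuization from `x`. -/
def continuousMixingTimeFrom (P : Matrix Ω Ω ℝ) (π : Ω → ℝ) (x : Ω) (ε : ℝ) : ℝ :=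
  sInf (continuousMixingSet P π x ε)

/-- The mixing time `τ = max_x τ_x` of the discrete-time chain (`Ω` is finite). -/
def discreteMixingTime (P : Matrix Ω Ω ℝ) (π : Ω → ℝ) (ε : ℝ) : ℕ :=
  ⨆ x, discreteMixingTimeFrom P π x ε

/-- The mixing time `τ = max_x τ_x` of the continuization (`Ω` is finite). -/
def continuousMixingTime (P : Matrix Ω Ω ℝ) (π : Ω → ℝ) (ε : ℝ) : ℝ :=
  ⨆ x, continuousMixingTimeFrom P π x ε

/-! ### Paths, flows and congestion -/

/-- The list of the edges `(x₀, x₁), …, (xₖ₋₁, xₖ)` traversed by the path `[x₀, …, xₖ]`, with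
repetitions. Its length is the length `|γ| = k` of the path, and the number `r((z, w), γ)` of times
that `(z, w)` appears on the path is the multiplicity of `(z, w)` in this list. -/
def pathEdges {α : Type*} (γ : List α) : List (α × α) := γ.zip γ.tail

/-- `γ = [x₀, …, xₖ]` is a path from `x` to `y` that uses transitions of positive probability of
`P` only (loops included), each of them at most twice. -/
structure IsPath (P : Matrix Ω Ω ℝ) (x y : Ω) (γ : List Ω) : Prop where
  head_eq : γ.head? = some x
  last_eq : γ.getLast? = some y
  pos : ∀ e ∈ pathEdges γ, 0 < P e.1 e.2
  count_le : ∀ e : Ω × Ω, (pathEdges γ).count e ≤ 2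

/-- `γ` is a path of `P` from `x` to `y` for some pair of states `(x, y)`, distinct or not, with
`P' x y > 0`. -/
def IsFlowPath (P P' : Matrix Ω Ω ℝ) (γ : List Ω) : Prop :=
  ∃ x y, 0 < P' x y ∧ IsPath P x y γ

theorem finite_isFlowPath (P P' : Matrix Ω Ω ℝ) : {γ : List Ω | IsFlowPath P P' γ}.Finite := by
  refine (List.finite_length_le Ω (2 * Fintype.card (Ω × Ω) + 1)).subset ?_
  rintro γ ⟨x, y, -, h⟩
  have h1 : ∑ e : Ω × Ω, (pathEdges γ).count e = (pathEdges γ).length := by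
    have := Multiset.sum_count_eq_card (s := Finset.univ) (m := (pathEdges γ : Multiset (Ω × Ω)))
      (fun a _ => Finset.mem_univ a)
    rw [Multiset.coe_card] at this
    rw [← this]
    refine Finset.sum_congr rfl fun e _ => ?_
    rw [Multiset.coe_count]
    congr 1
    exact lawful_beq_subsingleton _ _
  have h2 : ∑ e : Ω × Ω, (pathEdges γ).count e ≤ ∑ _e : Ω × Ω, 2 :=
    Finset.sum_le_sum fun e _ => h.count_le e
  have h3 : (pathEdges γ).length = γ.length - 1 := by simp [pathEdges]
  have h4 : ∑ _e : Ω × Ω, 2 = 2 * Fintype.card (Ω × Ω) := by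
    rw [Finset.sum_const, Finset.card_univ, smul_eq_mul, Nat.mul_comm]
  show γ.length ≤ _
  omega

/-- The set of all paths of `P` between pairs `(x, y)` with `P' x y > 0`. -/
abbrev FlowPath (P P' : Matrix Ω Ω ℝ) : Type _ := {γ : List Ω // IsFlowPath P P' γ}

instance instFintypeFlowPath (P P' : Matrix Ω Ω ℝ) : Fintype (FlowPath P P') :=
  (finite_isFlowPath P P').fintype

open Classical in
/-- A flow from the chain `P` to the chain `P'` with stationary distribution `π'` of `P'`: a
function from paths to `[0, 1]` which, for every pair `(x, y)` with `P' x y > 0`, distributes the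
weight `π' x * P' x y` over the paths of `P` from `x` to `y`. -/
structure Flow (P P' : Matrix Ω Ω ℝ) (π' : Ω → ℝ) where
  toFun : FlowPath P P' → ℝ
  mem_Icc : ∀ γ, toFun γ ∈ Set.Icc (0 : ℝ) 1
  sum_eq : ∀ x y, 0 < P' x y →
    ∑ γ : FlowPath P P' with IsPath P x y γ.1, toFun γ = π' x * P' x y

/-- The congestion `A_{z,w}(f)` of the edge `e = (z, w)` in a flow. Paths that avoid `e` contribute
`0` to the sum. -/
def Flow.edgeCongestion {P P' : Matrix Ω Ω ℝ} {π' : Ω → ℝ} (f : Flow P P' π') (π : Ω → ℝ)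
    (e : Ω × Ω) : ℝ :=
  1 / (π e.1 * P e.1 e.2) *
    ∑ γ : FlowPath P P',
      ((pathEdges γ.1).count e : ℝ) * ((pathEdges γ.1).length : ℝ) * f.toFun γ

/-- The congestion `A(f)` of a flow: the maximum of the congestions of the edges `(z, w)` (distinct
or not) with `P z w > 0`, where `π` is the stationary distribution of `P`. -/
def Flow.congestion {P P' : Matrix Ω Ω ℝ} {π' : Ω → ℝ} (f : Flow P P' π') (π : Ω → ℝ) : ℝ :=
  ⨆ e : {e : Ω × Ω // 0 < P e.1 e.2}, f.edgeCongestion π e.1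

end ChainComparison

end

set_option linter.unusedSectionVars false

namespace ChainComparison

open Finset Matrix

variable {Ω : Type*} [Fintype Ω] [DecidableEq Ω]

/-! A Poincaré inequality for `P'`, read off from its mixing time, is carried to `P` along the flow
and then forces the continuization of `P` to mix.

Mixing gives Poincaré (`piVariance_le_of_mixing`). Let F ≥ 0 live on a set S with π(S) ≤ 1/2. By the
mixing time T, a share of at least c = 1/2 - η of the mass of πF has left S. As the chain contracts
ℓ¹, displacement up to T is at most T times the one-step displacement, which is bounded by the ℓ¹
gradient of F. Taking F = g², Cauchy–Schwarz gives c² ∑ π g² ≤ T² E'(g), with E' the Dirichlet form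
of `P'`. Splitting φ at a median gives c² Var φ ≤ T² E'(φ). The same argument serves discrete and
continuous time.

Comparison (`dirichletForm_le_congestion_mul`). Telescoping φ along flow paths and applying
Cauchy–Schwarz gives E' ≤ A(f) E.

Decay (`mem_continuousMixingSet_of_piVariance_le`). Along the continuization the χ²-distance to π
has derivative exactly -E of the centred density, so it decays exponentially from 1/π(x) - 1, and it
dominates the squared ℓ¹ distance. Only stationarity is used, never reversibility. -/

/-- The Dirichlet form `∑ π x * P x y * (φ x - φ y) ^ 2`, with each unordered pair counted twice. -/
def dirichletForm (P : Matrix Ω Ω ℝ) (π φ : Ω → ℝ) : ℝ :=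
  ∑ x, ∑ y, π x * P x y * (φ x - φ y) ^ 2

/-- The variance of `φ` under the probability vector `π`. -/
def piVariance (π φ : Ω → ℝ) : ℝ := ∑ x, π x * φ x ^ 2 - (∑ x, π x * φ x) ^ 2

/-! ### The `ℓ¹` norm and stochastic matrices -/

theorem sum_abs_vecMul_le {M : Matrix Ω Ω ℝ} {c : ℝ} (h0 : ∀ i j, 0 ≤ M i j)
    (h1 : ∀ i, ∑ j, M i j = c) (u : Ω → ℝ) : ∑ j, |(u ᵥ* M) j| ≤ c * ∑ i, |u i| := by
  calc ∑ j, |(u ᵥ* M) j| ≤ ∑ j, ∑ i, |u i| * M i j := by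
        refine sum_le_sum fun j _ => ?_
        refine (abs_sum_le_sum_abs _ _).trans (sum_le_sum fun i _ => ?_)
        rw [abs_mul, abs_of_nonneg (h0 i j)]
    _ = c * ∑ i, |u i| := by
        rw [sum_comm, mul_sum]
        refine sum_congr rfl fun i _ => ?_
        rw [← mul_sum, h1, mul_comm]

theorem sum_abs_vecMul_le_of_mem_rowStochastic {M : Matrix Ω Ω ℝ}
    (hM : M ∈ rowStochastic ℝ Ω) (u : Ω → ℝ) : ∑ j, |(u ᵥ* M) j| ≤ ∑ i, |u i| := by
  simpa using sum_abs_vecMul_le (mem_rowStochastic_iff_sum.1 hM).1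
    (mem_rowStochastic_iff_sum.1 hM).2 u

theorem sum_vecMul_of_mem_rowStochastic {M : Matrix Ω Ω ℝ}
    (hM : M ∈ rowStochastic ℝ Ω) (u : Ω → ℝ) : ∑ j, (u ᵥ* M) j = ∑ i, u i := by
  simp only [vecMul, dotProduct]
  rw [sum_comm]
  refine sum_congr rfl fun i _ => ?_
  rw [← mul_sum, sum_row_of_mem_rowStochastic hM, mul_one]

/-- The positive and negative parts have equal mass, namely half the ℓ¹ norm. -/
theorem two_mul_sum_le_sum_abs {u : Ω → ℝ} (hu : ∑ i, u i = 0) (S : Finset Ω) :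
    2 * ∑ i ∈ S, u i ≤ ∑ i, |u i| := by
  have h := sum_add_sum_compl S u
  have h' := sum_add_sum_compl S fun i => |u i|
  have h1 : ∑ i ∈ S, u i ≤ ∑ i ∈ S, |u i| := sum_le_sum fun i _ => le_abs_self _
  have h2 : ∑ i ∈ Sᶜ, -u i ≤ ∑ i ∈ Sᶜ, |u i| := sum_le_sum fun i _ => neg_le_abs _
  rw [sum_neg_distrib] at h2
  linarith

/-- Each further step adds at most the first displacement, since `P` contracts ℓ¹. -/
theorem sum_abs_vecMul_pow_sub_le {P : Matrix Ω Ω ℝ} (hP : P ∈ rowStochastic ℝ Ω) (t : ℕ)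
    (ν : Ω → ℝ) : ∑ i, |(ν ᵥ* P ^ t) i - ν i| ≤ t * ∑ i, |(ν ᵥ* P) i - ν i| := by
  induction t with
  | zero => simp
  | succ t ih =>
    have h : ∀ i, (ν ᵥ* P ^ (t + 1)) i - ν i =
        ((ν ᵥ* P ^ t - ν) ᵥ* P) i + ((ν ᵥ* P) i - ν i) := fun i => by
      rw [sub_vecMul, vecMul_vecMul, ← pow_succ, Pi.sub_apply]; ring
    calc ∑ i, |(ν ᵥ* P ^ (t + 1)) i - ν i|
        ≤ ∑ i, |((ν ᵥ* P ^ t - ν) ᵥ* P) i| + ∑ i, |(ν ᵥ* P) i - ν i| := by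
          rw [← sum_add_distrib]
          exact sum_le_sum fun i _ => by rw [h]; exact abs_add_le _ _
      _ ≤ ∑ i, |(ν ᵥ* P ^ t) i - ν i| + ∑ i, |(ν ᵥ* P) i - ν i| := by
          refine add_le_add_left ?_ _
          simpa using sum_abs_vecMul_le_of_mem_rowStochastic hP (ν ᵥ* P ^ t - ν)
      _ ≤ _ := by push_cast; linarith

/-! ### The continuous-time semigroup -/

section Exp

open scoped Matrix.Norms.Operator

theorem hasDerivAt_vecMul_exp (Q : Matrix Ω Ω ℝ) (u : Ω → ℝ) (t : ℝ) :
    HasDerivAt (fun s : ℝ => u ᵥ* NormedSpace.exp (s • Q))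
      ((u ᵥ* NormedSpace.exp (t • Q)) ᵥ* Q) t := by
  have h := hasDerivAt_exp_smul_const (𝕂 := ℝ) Q t
  rw [vecMul_vecMul]
  let L : Matrix Ω Ω ℝ →ₗ[ℝ] (Ω → ℝ) :=
    { toFun := fun M => u ᵥ* M
      map_add' := fun A B => vecMul_add A B u
      map_smul' := fun c A => vecMul_smul u c A }
  exact (LinearMap.toContinuousLinearMap L).hasFDerivAt.comp_hasDerivAt t h

theorem exp_nonneg_of_nonneg {A : Matrix Ω Ω ℝ} (hA : ∀ i j, 0 ≤ A i j) (i j : Ω) :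
    0 ≤ NormedSpace.exp A i j := by
  have h := NormedSpace.exp_series_hasSum_exp' (𝕂 := ℝ) A
  have h2 : HasSum (fun n : ℕ => ((n.factorial : ℝ)⁻¹ • A ^ n) i j) (NormedSpace.exp A i j) :=
    h.map (entryAddMonoidHom ℝ i j) (continuous_id.matrix_elem i j)
  refine h2.nonneg fun n => ?_
  rw [Matrix.smul_apply, smul_eq_mul]
  exact mul_nonneg (by positivity) (pow_apply_nonneg hA n i j)

theorem commute_exp_smul (Q : Matrix Ω Ω ℝ) (t : ℝ) :
    Commute Q (NormedSpace.exp (t • Q)) :=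
  ((Commute.refl Q).smul_right t).exp_right

end Exp

/-- The generator can have negative diagonal entries; factoring out e^(-t) leaves a series with
nonnegative terms when `P` is nonnegative and t ≥ 0. -/
theorem exp_smul_sub_one (P : Matrix Ω Ω ℝ) (t : ℝ) :
    NormedSpace.exp (t • (P - 1)) = Real.exp (-t) • NormedSpace.exp (t • P) := by
  have h : t • (P - 1) = t • P + (-t) • (1 : Matrix Ω Ω ℝ) := by
    rw [smul_sub, neg_smul, sub_eq_add_neg]
  have h1 : NormedSpace.exp ((-t) • (1 : Matrix Ω Ω ℝ)) = Real.exp (-t) • 1 := by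
    rw [smul_one_eq_diagonal, exp_diagonal, smul_one_eq_diagonal]
    congr 1
    ext i
    rw [Pi.coe_exp, Real.exp_eq_exp_ℝ]
  rw [h, exp_add_of_commute _ _ ((Commute.one_right _).smul_right _), h1, Matrix.mul_smul, mul_one]

theorem exp_mulVec_one {P : Matrix Ω Ω ℝ} (hP : P ∈ rowStochastic ℝ Ω) (t : ℝ) (i : Ω) :
    ∑ j, NormedSpace.exp (t • (P - 1)) i j = 1 := by
  have hd : ∀ s : ℝ, HasDerivAt (fun s : ℝ => ∑ j, (Pi.single i 1 ᵥ*
      NormedSpace.exp (s • (P - 1))) j) 0 s := fun s => by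
    have h := hasDerivAt_pi.1 (hasDerivAt_vecMul_exp (P - 1) (Pi.single i 1) s)
    have h2 := HasDerivAt.fun_sum (u := univ) fun j _ => h j
    refine h2.congr_deriv ?_
    simp only [vecMul_sub, vecMul_one, Pi.sub_apply, sum_sub_distrib]
    rw [sum_vecMul_of_mem_rowStochastic hP, sub_self]
  have h := is_const_of_deriv_eq_zero (fun s => (hd s).differentiableAt) (fun s => (hd s).deriv) t 0
  simpa [single_one_vecMul, Matrix.one_apply] using h

theorem exp_mem_rowStochastic {P : Matrix Ω Ω ℝ} (hP : P ∈ rowStochastic ℝ Ω) {t : ℝ}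
    (ht : 0 ≤ t) : NormedSpace.exp (t • (P - 1)) ∈ rowStochastic ℝ Ω := by
  refine mem_rowStochastic_iff_sum.2 ⟨fun i j => ?_, exp_mulVec_one hP t⟩
  rw [exp_smul_sub_one, Matrix.smul_apply, smul_eq_mul]
  refine mul_nonneg (Real.exp_nonneg _) (exp_nonneg_of_nonneg (fun i j => ?_) i j)
  exact mul_nonneg ht (hP.1 i j)

theorem sum_abs_vecMul_exp_sub_le {P : Matrix Ω Ω ℝ} (hP : P ∈ rowStochastic ℝ Ω) {t : ℝ}
    (ht : 0 ≤ t) (ν : Ω → ℝ) :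
    ∑ i, |(ν ᵥ* NormedSpace.exp (t • (P - 1))) i - ν i| ≤ t * ∑ i, |(ν ᵥ* P) i - ν i| := by
  set E : ℝ → Matrix Ω Ω ℝ := fun s => NormedSpace.exp (s • (P - 1)) with hE
  have hE0 : E 0 = 1 := by simp [hE]
  -- Freezing the signs at the final time turns the ℓ¹ norm into a linear functional, which is
  -- differentiable in `s`.
  let σ : Ω → ℝ := fun i => SignType.sign ((ν ᵥ* E t) i - ν i)
  have hσ : ∀ i, |σ i| ≤ 1 := fun i => by
    simp only [σ]
    rcases lt_trichotomy ((ν ᵥ* E t) i - ν i) 0 with h | h | h <;> simp [h]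
  have hd : ∀ s, HasDerivAt (fun s : ℝ => ∑ i, σ i * (ν ᵥ* E s) i)
      (∑ i, σ i * ((ν ᵥ* P - ν) ᵥ* E s) i) s := fun s => by
    have h := hasDerivAt_pi.1 (hasDerivAt_vecMul_exp (P - 1) ν s)
    have h2 := HasDerivAt.fun_sum (u := univ) fun j _ => (h j).const_mul (σ j)
    refine h2.congr_deriv ?_
    -- The generator commutes with its semigroup, so it can act on `ν` first; the stochastic matrix
    -- `E s` then contracts ℓ¹.
    rw [vecMul_vecMul, ← (commute_exp_smul (P - 1) s).eq, ← vecMul_vecMul, vecMul_sub,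
      vecMul_one]
  have hb : ∀ s, 0 ≤ s → ∑ i, σ i * ((ν ᵥ* P - ν) ᵥ* E s) i ≤ ∑ i, |(ν ᵥ* P) i - ν i| := by
    intro s hs
    refine le_trans (sum_le_sum fun i _ => ?_)
      (sum_abs_vecMul_le_of_mem_rowStochastic (exp_mem_rowStochastic hP hs) (ν ᵥ* P - ν))
    calc _ ≤ |σ i * ((ν ᵥ* P - ν) ᵥ* E s) i| := le_abs_self _
      _ ≤ 1 * |((ν ᵥ* P - ν) ᵥ* E s) i| := by rw [abs_mul]; gcongr; exact hσ i
      _ = _ := one_mul _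
  have hm := Convex.image_sub_le_mul_sub_of_deriv_le (convex_Icc (0 : ℝ) t)
    (f := fun s : ℝ => ∑ i, σ i * (ν ᵥ* E s) i)
    (fun s _ => (hd s).continuousAt.continuousWithinAt)
    (fun s _ => (hd s).differentiableAt.differentiableWithinAt)
    (C := ∑ i, |(ν ᵥ* P) i - ν i|)
    (fun s hs => by rw [(hd s).deriv]; exact hb s (interior_subset hs).1)
    0 ⟨le_rfl, ht⟩ t ⟨ht, le_rfl⟩ ht
  rw [sub_zero, mul_comm] at hm
  refine le_of_eq_of_le ?_ hm
  simp only [hE0, vecMul_one]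
  rw [← sum_sub_distrib]
  refine sum_congr rfl fun i _ => ?_
  rw [← mul_sub, sign_mul_self]

/-! ### Stationary distributions and convergence -/

theorem nonempty_of_mem_stdSimplex {π : Ω → ℝ} (hπ : π ∈ stdSimplex ℝ Ω) : Nonempty Ω := by
  by_contra h
  rw [not_nonempty_iff] at h
  simpa using hπ.2

theorem IsStationary.vecMul_pow {P : Matrix Ω Ω ℝ} {π : Ω → ℝ} (h : IsStationary P π) (n : ℕ) :
    π ᵥ* P ^ n = π := by
  induction n with
  | zero => simp
  | succ n ih => rw [pow_succ, ← vecMul_vecMul, ih, h.vecMul_eq]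

theorem IsStationary.pos {P : Matrix Ω Ω ℝ} {π : Ω → ℝ} (h : IsStationary P π)
    (hP : P.IsIrreducible) (y : Ω) : 0 < π y := by
  obtain ⟨x, hx⟩ : ∃ x, 0 < π x := by
    by_contra! hc
    have := sum_nonpos fun i (_ : i ∈ univ) => hc i
    linarith [h.mem_stdSimplex.2]
  obtain ⟨k, -, hk⟩ := (isIrreducible_iff_exists_pow_pos hP.nonneg).1 hP x y
  rw [← h.vecMul_pow k]
  exact (mul_pos hx hk).trans_le (single_le_sum (f := fun i => π i * (P ^ k) i y)
    (fun i _ => mul_nonneg (h.mem_stdSimplex.1 i) (pow_apply_nonneg hP.nonneg k i y)) (mem_univ x))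

theorem pow_add_apply_pos {P : Matrix Ω Ω ℝ} (hP : ∀ i j, 0 ≤ P i j) {a b : ℕ} {x y z : Ω}
    (h1 : 0 < (P ^ a) x y) (h2 : 0 < (P ^ b) y z) : 0 < (P ^ (a + b)) x z := by
  rw [pow_add, mul_apply]
  exact (mul_pos h1 h2).trans_le (single_le_sum (f := fun i => (P ^ a) x i * (P ^ b) i z)
    (fun i _ => mul_nonneg (pow_apply_nonneg hP a x i) (pow_apply_nonneg hP b i z)) (mem_univ y))

/-- The return times to a state form an additive monoid of gcd 1, hence contain all large integers;
irreducibility links the states. -/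
theorem IsErgodic.exists_pow_pos {P : Matrix Ω Ω ℝ} (hP : IsErgodic P) :
    ∃ N, ∀ x y, 0 < (P ^ N) x y := by
  have h0 := hP.connected.nonneg
  have hret : ∀ x, ∃ n, ∀ m ≥ n, 0 < (P ^ m) x x := fun x => by
    let T : AddSubmonoid ℕ :=
      { carrier := {n | 0 < (P ^ n) x x}
        zero_mem' := by simp
        add_mem' := fun ha hb => pow_add_apply_pos h0 ha hb }
    obtain ⟨n, hn⟩ := Nat.exists_mem_closure_of_ge (T : Set ℕ)
    have h1 : Nat.setGcd (T : Set ℕ) = 1 :=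
      hP.aperiodic x _ fun m _ hm => Nat.setGcd_dvd_of_mem hm
    rw [h1, AddSubmonoid.closure_eq] at hn
    exact ⟨n, fun m hm => hn m hm (one_dvd m)⟩
  choose n hn using hret
  choose k hk0 hk using (isIrreducible_iff_exists_pow_pos h0).1 hP.connected
  refine ⟨∑ x, n x + ∑ x, ∑ y, k x y, fun x y => ?_⟩
  have h1 : n x ≤ ∑ x, n x := single_le_sum (fun _ _ => Nat.zero_le _) (mem_univ x)
  have h2 : k x y ≤ ∑ x, ∑ y, k x y :=
    (single_le_sum (f := fun y => k x y) (fun _ _ => Nat.zero_le _) (mem_univ y)).trans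
      (single_le_sum (f := fun x => ∑ y, k x y) (fun _ _ => Nat.zero_le _) (mem_univ x))
  have := pow_add_apply_pos h0 (hn x (∑ x, n x + ∑ x, ∑ y, k x y - k x y) (by omega)) (hk x y)
  rwa [Nat.sub_add_cancel (by omega)] at this

/-- Doeblin's argument: if all entries of P^N are at least δ, removing δπ from every row leaves a
nonnegative matrix with row sums 1 - δ, and the removed part kills vectors of sum zero. -/
theorem exists_contraction {P : Matrix Ω Ω ℝ} {π : Ω → ℝ} (hP : IsErgodic P)
    (hπ : IsStationary P π) : ∃ N : ℕ, ∃ c : ℝ, 0 ≤ c ∧ c < 1 ∧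
      ∀ u : Ω → ℝ, ∑ i, u i = 0 → ∑ i, |(u ᵥ* P ^ N) i| ≤ c * ∑ i, |u i| := by
  obtain ⟨N, hN⟩ := hP.exists_pow_pos
  obtain ⟨δ, hδ, hδN⟩ : ∃ δ : ℝ, 0 < δ ∧ ∀ x y, δ ≤ (P ^ N) x y := by
    rcases isEmpty_or_nonempty Ω with h | h
    · exact ⟨1, one_pos, fun x => h.elim x⟩
    · obtain ⟨p, hp⟩ := Finite.exists_min fun p : Ω × Ω => (P ^ N) p.1 p.2
      exact ⟨_, hN p.1 p.2, fun x y => hp (x, y)⟩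
  have hst : P ^ N ∈ rowStochastic ℝ Ω := pow_mem hP.stochastic N
  have hle : ∀ y, π y ≤ 1 := fun y => by
    rw [← hπ.mem_stdSimplex.2]
    exact single_le_sum (fun i _ => hπ.mem_stdSimplex.1 i) (mem_univ y)
  obtain ⟨x0⟩ := nonempty_of_mem_stdSimplex hπ.mem_stdSimplex
  let R : Matrix Ω Ω ℝ := P ^ N - of fun _ y => δ * π y
  have hR0 : ∀ i j, 0 ≤ R i j := fun i j => by
    have : δ * π j ≤ δ * 1 := by gcongr; exact hle j
    simp only [R, Matrix.sub_apply, of_apply]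
    linarith [hδN i j]
  have hR1 : ∀ i, ∑ j, R i j = 1 - δ := fun i => by
    simp only [R, Matrix.sub_apply, of_apply, sum_sub_distrib, ← mul_sum, hπ.mem_stdSimplex.2,
      sum_row_of_mem_rowStochastic hst, mul_one]
  refine ⟨N, 1 - δ, ?_, by linarith, fun u hu => ?_⟩
  · rw [← hR1 x0]
    exact sum_nonneg fun j _ => hR0 x0 j
  · have h : u ᵥ* R = u ᵥ* P ^ N := by
      simp only [R, vecMul_sub, sub_eq_self]
      ext j
      simp only [vecMul, dotProduct, of_apply, ← sum_mul, hu, zero_mul, Pi.zero_apply]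
    rw [← h]
    exact sum_abs_vecMul_le hR0 hR1 u

theorem discreteMixingSet_nonempty {P : Matrix Ω Ω ℝ} {π : Ω → ℝ} (hP : IsErgodic P)
    (hπ : IsStationary P π) (x : Ω) {ε : ℝ} (hε : 0 < ε) : (discreteMixingSet P π x ε).Nonempty := by
  obtain ⟨N, c, hc0, hc1, hc⟩ := exists_contraction hP hπ
  set u : Ω → ℝ := Pi.single x 1 - π with hu
  have hu0 : ∑ i, u i = 0 := by simp [hu, hπ.mem_stdSimplex.2]
  have hpow : ∀ k, ∑ i, |(u ᵥ* P ^ (N * k)) i| ≤ c ^ k * ∑ i, |u i| := fun k => by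
    induction k with
    | zero => simp
    | succ k ih =>
      rw [Nat.mul_succ, pow_add, ← vecMul_vecMul, pow_succ', mul_assoc]
      refine (hc _ ?_).trans (by gcongr)
      rw [sum_vecMul_of_mem_rowStochastic (pow_mem hP.stochastic _), hu0]
  have hlim : Filter.Tendsto (fun k : ℕ => c ^ k * ∑ i, |u i|) Filter.atTop (nhds 0) := by
    simpa using (tendsto_pow_atTop_nhds_zero_of_lt_one hc0 hc1).mul_const (∑ i, |u i|)
  obtain ⟨k, hk⟩ := (hlim.eventually (gt_mem_nhds hε)).exists
  -- The extra 1 keeps the time positive.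
  refine ⟨N * k + 1, Nat.succ_pos _, fun t ht => ?_⟩
  have h1 : ∀ i, discreteLaw P x t i - π i = ((u ᵥ* P ^ (N * k)) ᵥ* P ^ (t - N * k)) i := by
    intro i
    rw [vecMul_vecMul, ← pow_add, Nat.add_sub_cancel' (by omega), hu, sub_vecMul, hπ.vecMul_pow]
    rfl
  unfold variationDist
  simp only [h1]
  have h2 := sum_abs_vecMul_le_of_mem_rowStochastic (pow_mem hP.stochastic (t - N * k))
    (u ᵥ* P ^ (N * k))
  have h3 : 0 ≤ ∑ i, |((u ᵥ* P ^ (N * k)) ᵥ* P ^ (t - N * k)) i| := by positivity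
  linarith [hpow k]


/-! ### From mixing to a Poincaré inequality -/

theorem sum_stationary_mul {P : Matrix Ω Ω ℝ} {π : Ω → ℝ} (hπ : IsStationary P π) (a : Ω → ℝ) :
    ∑ x, ∑ y, π x * P x y * a y = ∑ y, π y * a y := by
  rw [sum_comm]
  refine sum_congr rfl fun y _ => ?_
  rw [← sum_mul]
  congr 1
  exact congrFun hπ.vecMul_eq y

theorem sum_stochastic_mul {P : Matrix Ω Ω ℝ} (hP : P ∈ rowStochastic ℝ Ω) (π a : Ω → ℝ) :
    ∑ x, ∑ y, π x * P x y * a x = ∑ x, π x * a x := by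
  refine sum_congr rfl fun x _ => ?_
  rw [← sum_mul, ← mul_sum, sum_row_of_mem_rowStochastic hP, mul_one]

theorem sum_abs_vecMul_sub_le {P : Matrix Ω Ω ℝ} {π : Ω → ℝ} (hP : P ∈ rowStochastic ℝ Ω)
    (hπ : IsStationary P π) (F : Ω → ℝ) :
    ∑ y, |((fun z => π z * F z) ᵥ* P) y - π y * F y| ≤
      ∑ x, ∑ y, π x * P x y * |F x - F y| := by
  rw [sum_comm (f := fun x y => π x * P x y * |F x - F y|)]
  refine sum_le_sum fun y _ => ?_
  have h : ((fun z => π z * F z) ᵥ* P) y - π y * F y = ∑ x, π x * P x y * (F x - F y) := by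
    conv_lhs => rw [← congrFun hπ.vecMul_eq y]
    simp only [vecMul, dotProduct, sum_mul, ← sum_sub_distrib]
    exact sum_congr rfl fun x _ => by ring
  rw [h]
  refine (abs_sum_le_sum_abs _ _).trans (sum_le_sum fun x _ => ?_)
  rw [abs_mul, abs_of_nonneg (mul_nonneg (hπ.mem_stdSimplex.1 x) (hP.1 x y))]

section Mixing

variable {P M : Matrix Ω Ω ℝ} {π : Ω → ℝ} {η t : ℝ}

/-- An ℓ¹ isoperimetric inequality: mass that must leave the support of `F` bounds the displacement
from below, and `hmove` bounds it from above. `M` stands for the law at time `t` in discrete or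
continuous time. -/
theorem mul_sum_le_of_mixing (hP : P ∈ rowStochastic ℝ Ω) (hπ : IsStationary P π)
    (hM : M ∈ rowStochastic ℝ Ω) (ht : 0 ≤ t) (hmix : ∀ y, variationDist (M y) π ≤ η)
    (hmove : ∀ ν : Ω → ℝ, ∑ i, |(ν ᵥ* M) i - ν i| ≤ t * ∑ i, |(ν ᵥ* P) i - ν i|)
    {F : Ω → ℝ} (hF : ∀ x, 0 ≤ F x) (hS : ∑ x with 0 < F x, π x ≤ 1 / 2) :
    2 * (1 / 2 - η) * ∑ x, π x * F x ≤ t * ∑ x, ∑ y, π x * P x y * |F x - F y| := by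
  set S : Finset Ω := {x | 0 < F x}
  set ν : Ω → ℝ := fun z => π z * F z with hν
  have hν0 : ∀ z, 0 ≤ ν z := fun z => mul_nonneg (hπ.mem_stdSimplex.1 z) (hF z)
  -- π gives Sᶜ mass at least 1/2, and `M z` differs from π by at most η on any set.
  have hesc : ∀ z, 1 / 2 - η ≤ ∑ y ∈ Sᶜ, M z y := fun z => by
    have h1 : ∑ y, (π y - M z y) = 0 := by
      rw [sum_sub_distrib, hπ.mem_stdSimplex.2, sum_row_of_mem_rowStochastic hM, sub_self]
    have h2 := two_mul_sum_le_sum_abs h1 Sᶜ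
    have h3 := hmix z
    have h4 := sum_add_sum_compl S π
    simp only [variationDist] at h3
    simp only [abs_sub_comm (π _)] at h2
    rw [sum_sub_distrib] at h2
    linarith [hπ.mem_stdSimplex.2]
  have h1 : (1 / 2 - η) * ∑ z, ν z ≤ ∑ y ∈ Sᶜ, ((ν ᵥ* M) y - ν y) := by
    have h2 : ∑ y ∈ Sᶜ, ((ν ᵥ* M) y - ν y) = ∑ y ∈ Sᶜ, (ν ᵥ* M) y := by
      refine sum_congr rfl fun y hy => ?_
      have : F y = 0 := by
        have : ¬ 0 < F y := by simpa [S] using hy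
        exact le_antisymm (not_lt.1 this) (hF y)
      simp [hν, this]
    rw [h2]
    simp only [vecMul, dotProduct]
    rw [sum_comm, mul_sum]
    refine sum_le_sum fun z _ => ?_
    rw [← mul_sum, mul_comm]
    exact mul_le_mul_of_nonneg_left (hesc z) (hν0 z)
  have h2 := two_mul_sum_le_sum_abs (u := fun y => (ν ᵥ* M) y - ν y)
    (by rw [sum_sub_distrib, sum_vecMul_of_mem_rowStochastic hM, sub_self]) Sᶜ
  have h3 := mul_le_mul_of_nonneg_left (sum_abs_vecMul_sub_le hP hπ F) ht
  linarith [hmove ν]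

theorem dirichletForm_nonneg (hP : ∀ i j, 0 ≤ P i j) (hπ : ∀ i, 0 ≤ π i) (φ : Ω → ℝ) :
    0 ≤ dirichletForm P π φ :=
  sum_nonneg fun x _ => sum_nonneg fun y _ =>
    mul_nonneg (mul_nonneg (hπ x) (hP x y)) (sq_nonneg _)

/-- Cauchy–Schwarz on |a² - b²| = |a - b| |a + b|; the 4 comes from (a + b)² ≤ 2a² + 2b², both
marginals of π(x)P(x,y) being π. -/
theorem sq_sum_abs_sq_sub_sq_le (hP : P ∈ rowStochastic ℝ Ω) (hπ : IsStationary P π)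
    (g : Ω → ℝ) : (∑ x, ∑ y, π x * P x y * |g x ^ 2 - g y ^ 2|) ^ 2 ≤
      dirichletForm P π g * (4 * ∑ x, π x * g x ^ 2) := by
  have hw : ∀ x y, 0 ≤ π x * P x y := fun x y => mul_nonneg (hπ.mem_stdSimplex.1 x) (hP.1 x y)
  have h1 : ∑ x, ∑ y, π x * P x y * (g x + g y) ^ 2 ≤ 4 * ∑ x, π x * g x ^ 2 := by
    calc ∑ x, ∑ y, π x * P x y * (g x + g y) ^ 2
        ≤ ∑ x, ∑ y, (2 * (π x * P x y * g x ^ 2) + 2 * (π x * P x y * g y ^ 2)) := by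
          refine sum_le_sum fun x _ => sum_le_sum fun y _ => ?_
          nlinarith [mul_nonneg (hw x y) (sq_nonneg (g x - g y))]
      _ = 4 * ∑ x, π x * g x ^ 2 := by
          simp only [sum_add_distrib, ← mul_sum]
          rw [sum_stationary_mul hπ fun y => g y ^ 2, sum_stochastic_mul hP π fun y => g y ^ 2]
          ring
  refine le_trans ?_ (mul_le_mul_of_nonneg_left h1
    (dirichletForm_nonneg hP.1 hπ.mem_stdSimplex.1 g))
  simp only [dirichletForm, ← Fintype.sum_prod_type']
  refine sum_sq_le_sum_mul_sum_of_sq_le_mul _ (fun p _ => mul_nonneg (hw _ _) (sq_nonneg _))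
    (fun p _ => mul_nonneg (hw _ _) (sq_nonneg _)) fun p _ => le_of_eq ?_
  rw [mul_pow, sq_abs]
  ring

theorem sq_mul_sum_sq_le_of_mixing (hP : P ∈ rowStochastic ℝ Ω) (hπ : IsStationary P π)
    (hM : M ∈ rowStochastic ℝ Ω) (ht : 0 ≤ t) (hη : η ≤ 1 / 2)
    (hmix : ∀ y, variationDist (M y) π ≤ η)
    (hmove : ∀ ν : Ω → ℝ, ∑ i, |(ν ᵥ* M) i - ν i| ≤ t * ∑ i, |(ν ᵥ* P) i - ν i|)
    {g : Ω → ℝ} (hS : ∑ x with g x ≠ 0, π x ≤ 1 / 2) :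
    (1 / 2 - η) ^ 2 * ∑ x, π x * g x ^ 2 ≤ t ^ 2 * dirichletForm P π g := by
  set G := ∑ x, π x * g x ^ 2
  have hG : 0 ≤ G := sum_nonneg fun x _ => mul_nonneg (hπ.mem_stdSimplex.1 x) (sq_nonneg _)
  have hD := dirichletForm_nonneg hP.1 hπ.mem_stdSimplex.1 g
  have h1 := mul_sum_le_of_mixing hP hπ hM ht hmix hmove (F := fun x => g x ^ 2)
    (fun x => sq_nonneg _) (by simpa only [sq_pos_iff] using hS)
  have h2 := sq_sum_abs_sq_sub_sq_le hP hπ g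
  have h3 : (2 * (1 / 2 - η) * G) ^ 2 ≤ t ^ 2 * (dirichletForm P π g * (4 * G)) := by
    refine (pow_le_pow_left₀ (mul_nonneg (by linarith) hG) h1 2).trans ?_
    rw [mul_pow]
    exact mul_le_mul_of_nonneg_left h2 (sq_nonneg t)
  -- The inequality `h3` is divided by 4G, so G = 0 is treated apart.
  rcases hG.eq_or_lt with h0 | h0
  · rw [← h0, mul_zero]
    exact mul_nonneg (sq_nonneg t) hD
  · refine le_of_mul_le_mul_right ?_ (mul_pos four_pos h0)
    linarith

theorem exists_median (hπ : π ∈ stdSimplex ℝ Ω) (φ : Ω → ℝ) :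
    ∃ m, ∑ x with m < φ x, π x ≤ 1 / 2 ∧ ∑ x with φ x < m, π x ≤ 1 / 2 := by
  have := nonempty_of_mem_stdSimplex hπ
  obtain ⟨xm, hxm⟩ := Finite.exists_max φ
  let T : Finset Ω := {z | ∑ x with φ z < φ x, π x ≤ 1 / 2}
  have hT : T.Nonempty := ⟨xm, by
    simp only [T, mem_filter, mem_univ, true_and]
    rw [filter_false_of_mem fun x _ => not_lt.2 (hxm x)]
    norm_num⟩
  obtain ⟨z, hz, hmin⟩ := exists_min_image T φ hT
  refine ⟨φ z, by simpa [T] using hz, ?_⟩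
  by_contra! hc
  have hne : ({x | φ x < φ z} : Finset Ω).Nonempty := by
    by_contra h
    rw [not_nonempty_iff_eq_empty.1 h] at hc
    norm_num at hc
  obtain ⟨v, hv, hmax⟩ := exists_max_image _ φ hne
  have hv' : φ v < φ z := by simpa using hv
  -- `v` has the largest value below φ z, so {φ > φ v} lies in the complement of a set of mass above
  -- 1/2; this contradicts the minimality of `z`.
  have hvT : v ∈ T := by
    simp only [T, mem_filter, mem_univ, true_and]
    have hsub : ({x | φ v < φ x} : Finset Ω) ⊆ ({x | φ x < φ z} : Finset Ω)ᶜ := fun x hx => by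
      simp only [mem_compl, mem_filter, mem_univ, true_and] at hx ⊢
      exact fun h => absurd (hmax x (by simpa using h)) (not_le.2 hx)
    have h1 := sum_le_sum_of_subset_of_nonneg hsub fun i _ _ => hπ.1 i
    have h2 := sum_add_sum_compl ({x | φ x < φ z} : Finset Ω) π
    linarith [hπ.2]
  exact absurd (hmin v hvT) (not_le.2 hv')

theorem piVariance_le_sum_sq_sub (hπ : π ∈ stdSimplex ℝ Ω) (φ : Ω → ℝ) (m : ℝ) :
    piVariance π φ ≤ ∑ x, π x * (φ x - m) ^ 2 := by
  have h : ∑ x, π x * (φ x - m) ^ 2 =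
      ∑ x, π x * φ x ^ 2 - 2 * m * ∑ x, π x * φ x + m ^ 2 * ∑ x, π x := by
    rw [mul_sum, mul_sum, ← sum_sub_distrib, ← sum_add_distrib]
    exact sum_congr rfl fun x _ => by ring
  rw [h, hπ.2, piVariance]
  nlinarith [sq_nonneg (∑ x, π x * φ x - m)]

theorem piVariance_le_of_mixing (hP : P ∈ rowStochastic ℝ Ω) (hπ : IsStationary P π)
    (hM : M ∈ rowStochastic ℝ Ω) (ht : 0 ≤ t) (hη : η ≤ 1 / 2)
    (hmix : ∀ y, variationDist (M y) π ≤ η)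
    (hmove : ∀ ν : Ω → ℝ, ∑ i, |(ν ᵥ* M) i - ν i| ≤ t * ∑ i, |(ν ᵥ* P) i - ν i|)
    (φ : Ω → ℝ) :
    (1 / 2 - η) ^ 2 * piVariance π φ ≤ t ^ 2 * dirichletForm P π φ := by
  obtain ⟨m, hm1, hm2⟩ := exists_median hπ.mem_stdSimplex φ
  set g : Ω → ℝ := fun x => max (φ x - m) 0 with hg
  set h : Ω → ℝ := fun x => max (m - φ x) 0 with hh
  have hgS : ∑ x with g x ≠ 0, π x ≤ 1 / 2 := by
    convert hm1 using 3
    simp [hg]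
  have hhS : ∑ x with h x ≠ 0, π x ≤ 1 / 2 := by
    convert hm2 using 3
    simp [hh]
  have h1 := sq_mul_sum_sq_le_of_mixing hP hπ hM ht hη hmix hmove hgS
  have h2 := sq_mul_sum_sq_le_of_mixing hP hπ hM ht hη hmix hmove hhS
  have h3 : ∑ x, π x * (φ x - m) ^ 2 = ∑ x, π x * g x ^ 2 + ∑ x, π x * h x ^ 2 := by
    rw [← sum_add_distrib]
    refine sum_congr rfl fun x _ => ?_
    rw [← mul_add]
    congr 1
    rcases le_total (φ x) m with hx | hx
    · simp only [hg, hh, max_eq_right (sub_nonpos.2 hx), max_eq_left (sub_nonneg.2 hx)]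
      ring
    · simp only [hg, hh, max_eq_right (sub_nonpos.2 hx), max_eq_left (sub_nonneg.2 hx)]
      ring
  -- If the median separates φ x from φ y, the increments of `g` and `h` have absolute values adding
  -- up to |φ x - φ y|; otherwise one of them vanishes.
  have h4 : dirichletForm P π g + dirichletForm P π h ≤ dirichletForm P π φ := by
    simp only [dirichletForm, ← sum_add_distrib]
    refine sum_le_sum fun x _ => sum_le_sum fun y _ => ?_
    rw [← mul_add]
    refine mul_le_mul_of_nonneg_left ?_ (mul_nonneg (hπ.mem_stdSimplex.1 x) (hP.1 x y))
    rcases le_total (φ x) m with hx | hx <;> rcases le_total (φ y) m with hy | hy <;>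
      simp only [hg, hh, max_eq_right (sub_nonpos.2 hx), max_eq_left (sub_nonneg.2 hx),
        max_eq_right (sub_nonpos.2 hy), max_eq_left (sub_nonneg.2 hy)] <;>
      nlinarith [mul_nonneg (sub_nonneg.2 hx) (sub_nonneg.2 hy)]
  calc _ ≤ (1 / 2 - η) ^ 2 * ∑ x, π x * (φ x - m) ^ 2 :=
        mul_le_mul_of_nonneg_left (piVariance_le_sum_sq_sub hπ.mem_stdSimplex φ m) (sq_nonneg _)
    _ ≤ t ^ 2 * (dirichletForm P π g + dirichletForm P π h) := by rw [h3]; linarith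
    _ ≤ _ := mul_le_mul_of_nonneg_left h4 (sq_nonneg t)

end Mixing

/-! ### Decay of the variance along the continuization -/

/-- Expanding the square, both diagonal terms equal ∑ π φ² by stationarity, and the cross term is
insensitive to reversibility. -/
theorem sum_mul_generator {P : Matrix Ω Ω ℝ} {π : Ω → ℝ} (hP : P ∈ rowStochastic ℝ Ω)
    (hπ : IsStationary P π) (φ : Ω → ℝ) :
    2 * ∑ y, φ y * ((fun z => π z * φ z) ᵥ* (P - 1)) y = -dirichletForm P π φ := by
  have h1 : dirichletForm P π φ = 2 * ∑ x, π x * φ x ^ 2 -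
      2 * ∑ x, ∑ y, π x * P x y * (φ x * φ y) := by
    have : dirichletForm P π φ = ∑ x, ∑ y, π x * P x y * φ x ^ 2 +
        ∑ x, ∑ y, π x * P x y * φ y ^ 2 - 2 * ∑ x, ∑ y, π x * P x y * (φ x * φ y) := by
      simp only [dirichletForm, mul_sum, ← sum_add_distrib, ← sum_sub_distrib]
      exact sum_congr rfl fun x _ => sum_congr rfl fun y _ => by ring
    rw [this, sum_stationary_mul hπ fun y => φ y ^ 2, sum_stochastic_mul hP π fun y => φ y ^ 2]
    ring
  have h2 : ∑ y, φ y * ((fun z => π z * φ z) ᵥ* (P - 1)) y =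
      ∑ x, ∑ y, π x * P x y * (φ x * φ y) - ∑ x, π x * φ x ^ 2 := by
    rw [sum_comm, ← sum_sub_distrib]
    refine sum_congr rfl fun y _ => ?_
    rw [vecMul_sub, vecMul_one, Pi.sub_apply, mul_sub]
    congr 1
    · simp only [vecMul, dotProduct, mul_sum]
      exact sum_congr rfl fun x _ => by ring
    · ring
  rw [h1, h2]
  ring

theorem hasDerivAt_chiSquare {P : Matrix Ω Ω ℝ} {π : Ω → ℝ} (hP : P ∈ rowStochastic ℝ Ω)
    (hπ : IsStationary P π) (hpos : ∀ y, 0 < π y) (x : Ω) (t : ℝ) :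
    HasDerivAt (fun s => ∑ y, (continuousLaw P x s y - π y) ^ 2 / π y)
      (-dirichletForm P π fun y => (continuousLaw P x t y - π y) / π y) t := by
  have h := hasDerivAt_pi.1 (hasDerivAt_vecMul_exp (P - 1) (Pi.single x 1) t)
  have h2 := HasDerivAt.fun_sum (u := univ) fun y _ =>
    (((h y).sub_const (π y)).pow 2).div_const (π y)
  refine h2.congr_deriv ?_
  rw [← sum_mul_generator hP hπ, mul_sum]
  refine sum_congr rfl fun y _ => ?_
  have h3 : (fun z => π z * ((continuousLaw P x t z - π z) / π z)) = continuousLaw P x t - π := by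
    ext z
    rw [mul_div_cancel₀ _ (hpos z).ne', Pi.sub_apply]
  have h4 : π ᵥ* (P - 1) = 0 := by rw [vecMul_sub, vecMul_one, hπ.vecMul_eq, sub_self]
  rw [h3, sub_vecMul, h4, sub_zero]
  simp only [continuousLaw]
  have := (hpos y).ne'
  field_simp
  ring

theorem piVariance_density {π μ : Ω → ℝ} (hπ : π ∈ stdSimplex ℝ Ω) (hpos : ∀ y, 0 < π y)
    (hμ : ∑ y, μ y = 1) :
    piVariance π (fun y => (μ y - π y) / π y) = ∑ y, (μ y - π y) ^ 2 / π y := by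
  have h1 : ∑ y, π y * ((μ y - π y) / π y) = 0 := by
    simp only [fun y => mul_div_cancel₀ (μ y - π y) (hpos y).ne', sum_sub_distrib, hμ, hπ.2,
      sub_self]
  rw [piVariance, h1, sq, mul_zero, sub_zero]
  refine sum_congr rfl fun y _ => ?_
  have := (hpos y).ne'
  field_simp

theorem sq_sum_abs_sub_le {π μ : Ω → ℝ} (hπ : π ∈ stdSimplex ℝ Ω) (hpos : ∀ y, 0 < π y) :
    (∑ y, |μ y - π y|) ^ 2 ≤ ∑ y, (μ y - π y) ^ 2 / π y := by
  have h := sum_sq_le_sum_mul_sum_of_sq_le_mul univ (r := fun y => |μ y - π y|)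
    (f := fun y => (μ y - π y) ^ 2 / π y) (g := π)
    (fun y _ => div_nonneg (sq_nonneg _) (hpos y).le) (fun y _ => (hpos y).le)
    fun y _ => by rw [sq_abs, div_mul_cancel₀ _ (hpos y).ne']
  rwa [hπ.2, mul_one] at h

theorem chiSquare_single {π : Ω → ℝ} (hπ : π ∈ stdSimplex ℝ Ω) (hpos : ∀ y, 0 < π y) (x : Ω) :
    ∑ y, ((Pi.single x 1 : Ω → ℝ) y - π y) ^ 2 / π y = 1 / π x - 1 := by
  have h : ∀ y, ((Pi.single x 1 : Ω → ℝ) y - π y) ^ 2 / π y =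
      (Pi.single x (1 / π x - 2) : Ω → ℝ) y + π y := fun y => by
    have := (hpos y).ne'
    rcases eq_or_ne y x with rfl | hy
    · simp only [Pi.single_eq_same]
      field_simp
      ring
    · simp only [Pi.single_eq_of_ne hy]
      field_simp
      ring
  simp only [h, sum_add_distrib, hπ.2, sum_pi_single', mem_univ, if_true]
  ring

theorem mem_continuousMixingSet_of_piVariance_le {P : Matrix Ω Ω ℝ} {π : Ω → ℝ} {k ε t : ℝ}
    (hP : P ∈ rowStochastic ℝ Ω) (hπ : IsStationary P π) (hpos : ∀ y, 0 < π y)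
    (hk : ∀ φ : Ω → ℝ, piVariance π φ ≤ k * dirichletForm P π φ) (x : Ω) (hε : 0 < ε)
    (hεπ : ε ^ 2 * π x ≤ 1) (ht : 0 < t) (hkt : k * Real.log (1 / (ε ^ 2 * π x)) ≤ t) :
    t ∈ continuousMixingSet P π x ε := by
  refine ⟨ht, fun s hs => ?_⟩
  have hs0 : 0 < s := ht.trans_le hs
  have hq : 0 < ε ^ 2 * π x := mul_pos (pow_pos hε 2) (hpos x)
  set L := Real.log (1 / (ε ^ 2 * π x)) with hL
  have hL0 : 0 ≤ L := Real.log_nonneg (by rw [le_div_iff₀ hq]; linarith)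
  set W : ℝ → ℝ := fun r => ∑ y, (continuousLaw P x r y - π y) ^ 2 / π y with hW
  set D : ℝ → ℝ := fun r => dirichletForm P π fun y => (continuousLaw P x r y - π y) / π y
    with hD
  -- The rate L / s, rather than 1 / k, makes the exponent equal L at time `s` and avoids dividing
  -- by `k`, which may be 0.
  have hder : ∀ r, HasDerivAt (fun r => Real.exp (L / s * r) * W r)
      (Real.exp (L / s * r) * (L / s) * W r + Real.exp (L / s * r) * -D r) r := fun r => by
    have h1 : HasDerivAt (fun r => Real.exp (L / s * r)) (Real.exp (L / s * r) * (L / s)) r := by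
      simpa using ((hasDerivAt_id r).const_mul (L / s)).exp
    exact h1.mul (hasDerivAt_chiSquare hP hπ hpos x r)
  have hle : ∀ r, L / s * W r ≤ D r := fun r => by
    have hD0 : 0 ≤ D r := dirichletForm_nonneg hP.1 hπ.mem_stdSimplex.1 _
    have h1 : W r ≤ k * D r := by
      have hsum : ∑ y, continuousLaw P x r y = 1 := by
        simp only [continuousLaw, single_one_vecMul, row]
        exact exp_mulVec_one hP r x
      have := hk fun y => (continuousLaw P x r y - π y) / π y
      rwa [piVariance_density hπ.mem_stdSimplex hpos hsum] at this
    rw [div_mul_eq_mul_div, div_le_iff₀ hs0]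
    calc L * W r ≤ L * (k * D r) := mul_le_mul_of_nonneg_left h1 hL0
      _ = (k * L) * D r := by ring
      _ ≤ s * D r := mul_le_mul_of_nonneg_right (hkt.trans hs) hD0
      _ = D r * s := mul_comm _ _
  have hanti : Antitone fun r => Real.exp (L / s * r) * W r :=
    antitone_of_deriv_nonpos (fun r => (hder r).differentiableAt) fun r => by
      rw [(hder r).deriv]
      have := mul_le_mul_of_nonneg_left (hle r) (Real.exp_nonneg (L / s * r))
      linarith
  have h0 : W 0 = 1 / π x - 1 := by
    rw [← chiSquare_single hπ.mem_stdSimplex hpos x]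
    simp only [hW, continuousLaw, zero_smul, NormedSpace.exp_zero, vecMul_one]
  have h1 := hanti hs0.le
  simp only [mul_zero, Real.exp_zero, one_mul, div_mul_cancel₀ L hs0.ne', h0] at h1
  rw [hL, Real.exp_log (one_div_pos.2 hq)] at h1
  have h2 : W s ≤ ε ^ 2 := by
    rw [one_div_mul_eq_div, div_le_iff₀ hq] at h1
    have h3 : (1 / π x - 1) * (ε ^ 2 * π x) = ε ^ 2 - ε ^ 2 * π x := by
      have := (hpos x).ne'
      field_simp
    linarith
  have h3 := abs_le_of_sq_le_sq
    ((sq_sum_abs_sub_le (μ := continuousLaw P x s) hπ.mem_stdSimplex hpos).trans h2) hε.le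
  have h4 := (le_abs_self _).trans h3
  rw [variationDist]
  linarith

/-! ### Comparison of Dirichlet forms along a flow -/

theorem sum_map_pathEdges_sub (φ : Ω → ℝ) {x y : Ω} {γ : List Ω} (hx : γ.head? = some x)
    (hy : γ.getLast? = some y) :
    ((pathEdges γ).map fun e => φ e.1 - φ e.2).sum = φ x - φ y := by
  induction γ generalizing x with
  | nil => simp at hx
  | cons a l ih =>
    obtain rfl : a = x := by simpa using hx
    cases l with
    | nil =>
      obtain rfl : a = y := by simpa using hy
      simp [pathEdges]
    | cons b l =>
      have := ih (x := b) rfl (by simpa using hy)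
      simp only [pathEdges, List.tail_cons, List.zip_cons_cons, List.map_cons, List.sum_cons]
        at this ⊢
      rw [this]
      ring

theorem sum_map_eq_sum_count_mul {α : Type*} [Fintype α] [b : BEq α] [LawfulBEq α] (l : List α)
    (h : α → ℝ) : (l.map h).sum = ∑ e, (l.count e : ℝ) * h e := by
  classical
  obtain rfl : b = instBEqOfDecidableEq := lawful_beq_subsingleton _ _
  induction l with
  | nil => simp
  | cons a l ih =>
    simp only [List.map_cons, List.sum_cons, ih, List.count_cons, beq_iff_eq, Nat.cast_add,
      add_mul, sum_add_distrib, Nat.cast_ite, Nat.cast_one, Nat.cast_zero, ite_mul, one_mul,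
      zero_mul, sum_ite_eq, mem_univ, if_true]
    ring

/-- Cauchy–Schwarz on the telescoping sum, weighted by edge multiplicities, whose total is the path
length. -/
theorem IsPath.sq_sub_le {P : Matrix Ω Ω ℝ} {x y : Ω} {γ : List Ω} (h : IsPath P x y γ)
    (φ : Ω → ℝ) : (φ x - φ y) ^ 2 ≤ ∑ e : Ω × Ω,
      ((pathEdges γ).count e : ℝ) * (pathEdges γ).length * (φ e.1 - φ e.2) ^ 2 := by
  rw [← sum_map_pathEdges_sub φ h.head_eq h.last_eq, sum_map_eq_sum_count_mul]
  have hl : ((pathEdges γ).length : ℝ) = ∑ e : Ω × Ω, ((pathEdges γ).count e : ℝ) := by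
    simpa using sum_map_eq_sum_count_mul (pathEdges γ) fun _ => 1
  refine (sum_sq_le_sum_mul_sum_of_sq_le_mul univ
    (f := fun e : Ω × Ω => ((pathEdges γ).count e : ℝ))
    (g := fun e : Ω × Ω => ((pathEdges γ).count e : ℝ) * (φ e.1 - φ e.2) ^ 2)
    (fun e _ => by positivity) (fun e _ => by positivity) fun e _ => le_of_eq (by ring)).trans_eq ?_
  rw [← hl, mul_sum]
  exact sum_congr rfl fun e _ => by ring

/-- A path determines its endpoints, so summing over pairs and then over their paths counts each
flow path once. -/
theorem dirichletForm_le_sum_flow {P P' : Matrix Ω Ω ℝ} {π : Ω → ℝ} (f : Flow P P' π)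
    (hP' : ∀ i j, 0 ≤ P' i j) (φ : Ω → ℝ) :
    dirichletForm P' π φ ≤ ∑ γ : FlowPath P P', f.toFun γ * ∑ e : Ω × Ω,
      ((pathEdges γ.1).count e : ℝ) * (pathEdges γ.1).length * (φ e.1 - φ e.2) ^ 2 := by
  classical
  have h1 : ∀ p : Ω × Ω, π p.1 * P' p.1 p.2 * (φ p.1 - φ p.2) ^ 2 =
      ∑ γ : FlowPath P P', if 0 < P' p.1 p.2 ∧ IsPath P p.1 p.2 γ.1 then
        f.toFun γ * (φ p.1 - φ p.2) ^ 2 else 0 := fun p => by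
    rcases (hP' p.1 p.2).eq_or_lt with h | h
    · simp [← h]
    · rw [← f.sum_eq _ _ h, sum_filter, sum_mul]
      refine sum_congr rfl fun γ _ => ?_
      simp [h]
  rw [dirichletForm, ← Fintype.sum_prod_type' fun x y => π x * P' x y * (φ x - φ y) ^ 2,
    sum_congr rfl fun p _ => h1 p, sum_comm]
  refine sum_le_sum fun γ _ => ?_
  obtain ⟨x, y, hxy, hγ⟩ := γ.2
  rw [sum_eq_single (x, y), if_pos ⟨hxy, hγ⟩]
  · exact mul_le_mul_of_nonneg_left (hγ.sq_sub_le φ) (f.mem_Icc γ).1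
  · rintro ⟨a, b⟩ - hne
    refine if_neg fun hab => hne ?_
    have h2 := hab.2.head_eq.symm.trans hγ.head_eq
    have h3 := hab.2.last_eq.symm.trans hγ.last_eq
    simp_all
  · simp

theorem Flow.edgeCongestion_le_congestion {P P' : Matrix Ω Ω ℝ} {π : Ω → ℝ} (f : Flow P P' π)
    {e : Ω × Ω} (he : 0 < P e.1 e.2) : f.edgeCongestion π e ≤ f.congestion π :=
  le_ciSup (f := fun e : {e : Ω × Ω // 0 < P e.1 e.2} => f.edgeCongestion π e.1)
    (Set.finite_range _).bddAbove ⟨e, he⟩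

theorem Flow.congestion_nonneg {P P' : Matrix Ω Ω ℝ} {π : Ω → ℝ} (f : Flow P P' π)
    (hπ : ∀ y, 0 ≤ π y) : 0 ≤ f.congestion π :=
  Real.iSup_nonneg fun e => mul_nonneg (one_div_nonneg.2 (mul_nonneg (hπ _) e.2.le))
    (sum_nonneg fun γ _ => mul_nonneg (by positivity) (f.mem_Icc γ).1)

theorem dirichletForm_le_congestion_mul {P P' : Matrix Ω Ω ℝ} {π : Ω → ℝ} (f : Flow P P' π)
    (hP : ∀ i j, 0 ≤ P i j) (hP' : ∀ i j, 0 ≤ P' i j) (hpos : ∀ y, 0 < π y) (φ : Ω → ℝ) :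
    dirichletForm P' π φ ≤ f.congestion π * dirichletForm P π φ := by
  refine (dirichletForm_le_sum_flow f hP' φ).trans ?_
  simp only [mul_sum, dirichletForm]
  rw [sum_comm, ← Fintype.sum_prod_type'
    fun x y => f.congestion π * (π x * P x y * (φ x - φ y) ^ 2)]
  refine sum_le_sum fun e _ => ?_
  rcases (hP e.1 e.2).eq_or_lt with he | he
  · rw [← he, mul_zero, zero_mul, mul_zero]
    -- No flow path uses an edge with P = 0.
    refine (sum_eq_zero fun γ _ => ?_).le
    obtain ⟨x, y, -, hγ⟩ := γ.2
    have : e ∉ pathEdges γ.1 := fun hmem => (hγ.pos e hmem).ne he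
    rw [List.count_eq_zero_of_not_mem this]
    simp
  · have hw : 0 < π e.1 * P e.1 e.2 := mul_pos (hpos _) he
    have h := f.edgeCongestion_le_congestion he
    rw [Flow.edgeCongestion, one_div_mul_eq_div, div_le_iff₀ hw] at h
    calc _ = (∑ γ : FlowPath P P', ((pathEdges γ.1).count e : ℝ) *
          ((pathEdges γ.1).length : ℝ) * f.toFun γ) * (φ e.1 - φ e.2) ^ 2 := by
          rw [sum_mul]
          exact sum_congr rfl fun γ _ => by ring
      _ ≤ _ := mul_le_mul_of_nonneg_right h (sq_nonneg _)
      _ = _ := by ring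

/-! ### Mixing times -/

theorem half_sub_pos : 0 < 1 / 2 - 1 / (2 * Real.exp 1) := by
  have h : 1 < Real.exp 1 := Real.one_lt_exp_iff.2 one_pos
  rw [sub_pos]
  exact one_div_lt_one_div_of_lt two_pos (by linarith)

theorem piVariance_le_discreteMixingTime {P : Matrix Ω Ω ℝ} {π : Ω → ℝ} (hP : IsErgodic P)
    (hπ : IsStationary P π) {η : ℝ} (hη0 : 0 < η) (hη : η ≤ 1 / 2) (φ : Ω → ℝ) :
    (1 / 2 - η) ^ 2 * piVariance π φ ≤
      (discreteMixingTime P π η : ℝ) ^ 2 * dirichletForm P π φ := by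
  refine piVariance_le_of_mixing hP.stochastic hπ (pow_mem hP.stochastic _) (Nat.cast_nonneg _) hη
    (fun y => ?_) (sum_abs_vecMul_pow_sub_le hP.stochastic (discreteMixingTime P π η)) φ
  have h := (Nat.sInf_mem (discreteMixingSet_nonempty hP hπ y hη0)).2 (discreteMixingTime P π η)
    (le_ciSup (f := fun x => discreteMixingTimeFrom P π x η) (Set.finite_range _).bddAbove y)
  rwa [discreteLaw, single_one_vecMul] at h

/-- The infimum need not be a mixing time itself (it could be 0), so the inequality is proved for
every larger `t` and passed to the limit. -/
theorem piVariance_le_continuousMixingTime {P : Matrix Ω Ω ℝ} {π : Ω → ℝ} (hP : IsErgodic P)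
    (hπ : IsStationary P π) {η : ℝ} (hη : η ≤ 1 / 2)
    (hne : ∀ y, (continuousMixingSet P π y η).Nonempty) (φ : Ω → ℝ) :
    (1 / 2 - η) ^ 2 * piVariance π φ ≤ continuousMixingTime P π η ^ 2 * dirichletForm P π φ := by
  have h0 : 0 ≤ continuousMixingTime P π η :=
    Real.iSup_nonneg fun y => Real.sInf_nonneg fun t ht => ht.1.le
  have h1 : ∀ t, continuousMixingTime P π η < t →
      (1 / 2 - η) ^ 2 * piVariance π φ ≤ t ^ 2 * dirichletForm P π φ := fun t ht => by
    have ht0 : 0 ≤ t := h0.trans ht.le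
    refine piVariance_le_of_mixing hP.stochastic hπ (exp_mem_rowStochastic hP.stochastic ht0) ht0
      hη (fun y => ?_) (sum_abs_vecMul_exp_sub_le hP.stochastic ht0) φ
    have hy : continuousMixingTimeFrom P π y η < t := lt_of_le_of_lt
      (le_ciSup (f := fun x => continuousMixingTimeFrom P π x η) (Set.finite_range _).bddAbove y) ht
    obtain ⟨s, hs, hst⟩ := exists_lt_of_csInf_lt (hne y) hy
    have h := hs.2 t hst.le
    rwa [continuousLaw, single_one_vecMul] at h
  have hc : Filter.Tendsto (fun t : ℝ => t ^ 2 * dirichletForm P π φ)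
      (nhdsWithin (continuousMixingTime P π η) (Set.Ioi (continuousMixingTime P π η)))
      (nhds (continuousMixingTime P π η ^ 2 * dirichletForm P π φ)) :=
    ((continuous_pow 2).mul continuous_const).continuousWithinAt
  exact ge_of_tendsto hc (eventually_mem_nhdsWithin.mono fun t ht => h1 t ht)

/-- Finiteness comes from the chain's own discrete mixing time: it yields a Poincaré inequality,
hence decay of the continuization. -/
theorem continuousMixingSet_nonempty {P : Matrix Ω Ω ℝ} {π : Ω → ℝ} (hP : IsErgodic P)
    (hπ : IsStationary P π) (x : Ω) {ε : ℝ} (hε : 0 < ε) (hεπ : ε ^ 2 * π x ≤ 1) :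
    (continuousMixingSet P π x ε).Nonempty := by
  have hc := half_sub_pos
  set c := 1 / 2 - 1 / (2 * Real.exp 1)
  set T : ℝ := (discreteMixingTime P π (1 / (2 * Real.exp 1)) : ℝ)
  have hk : ∀ φ : Ω → ℝ, piVariance π φ ≤ T ^ 2 / c ^ 2 * dirichletForm P π φ := fun φ => by
    rw [div_mul_eq_mul_div, le_div_iff₀' (pow_pos hc 2)]
    exact piVariance_le_discreteMixingTime hP hπ (by positivity) (sub_pos.1 hc).le φ
  exact ⟨_, mem_continuousMixingSet_of_piVariance_le hP.stochastic hπ (hπ.pos hP.connected) hk x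
    hε hεπ (lt_max_of_lt_left one_pos) (le_max_right _ _)⟩

/-- A Poincaré inequality for `P'` with constant `T ^ 2 / c ^ 2`, transported along a flow, bounds
the mixing time of the continuization of `P`. -/
theorem continuousMixingTimeFrom_le_of_flow {P P' : Matrix Ω Ω ℝ} {π : Ω → ℝ}
    (hP : IsErgodic P) (hP' : IsErgodic P') (hπ : IsStationary P π) (f : Flow P P' π) {c T ε : ℝ}
    (hc : 0 < c)
    (hT : ∀ φ : Ω → ℝ, c ^ 2 * piVariance π φ ≤ T ^ 2 * dirichletForm P' π φ)
    (x : Ω) (hε : 0 < ε) (hεπ : ε ^ 2 * π x ≤ 1) :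
    continuousMixingTimeFrom P π x ε ≤
      4 * f.congestion π * (T ^ 2 / c ^ 2) * Real.log (1 / (ε ^ 2 * π x)) := by
  have hpos := hπ.pos hP.connected
  have hA := f.congestion_nonneg fun y => (hpos y).le
  have hk : ∀ φ : Ω → ℝ, piVariance π φ ≤
      f.congestion π * (T ^ 2 / c ^ 2) * dirichletForm P π φ := fun φ => by
    have h1 : piVariance π φ ≤ T ^ 2 / c ^ 2 * dirichletForm P' π φ := by
      rw [div_mul_eq_mul_div, le_div_iff₀' (pow_pos hc 2)]
      exact hT φ
    have h2 := dirichletForm_le_congestion_mul f hP.stochastic.1 hP'.stochastic.1 hpos φ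
    calc _ ≤ _ := h1
      _ ≤ T ^ 2 / c ^ 2 * (f.congestion π * dirichletForm P π φ) := by gcongr
      _ = _ := by ring
  have hq : 0 < ε ^ 2 * π x := mul_pos (pow_pos hε 2) (hpos x)
  have hL : 0 ≤ Real.log (1 / (ε ^ 2 * π x)) :=
    Real.log_nonneg (by rw [le_div_iff₀ hq]; linarith)
  have hB : 0 ≤ f.congestion π * (T ^ 2 / c ^ 2) * Real.log (1 / (ε ^ 2 * π x)) := by positivity
  -- The argument gives the bound with constant 1 in place of 4. That bound may be 0, whereas mixing
  -- times are positive, so any `t` above it is used.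
  refine le_trans (le_of_forall_gt_imp_ge_of_dense fun t ht => ?_)
    (show f.congestion π * (T ^ 2 / c ^ 2) * Real.log (1 / (ε ^ 2 * π x)) ≤ _ by linarith)
  exact csInf_le ⟨0, fun s hs => hs.1.le⟩ (mem_continuousMixingSet_of_piVariance_le hP.stochastic
    hπ hpos hk x hε hεπ (hB.trans_lt ht) ht.le)

end ChainComparison

theorem theorem24 {Ω : Type*} [Fintype Ω] [DecidableEq Ω]
    (P P' : Matrix Ω Ω ℝ) (π : Ω → ℝ)
    (hP : ChainComparison.IsErgodic P) (hP' : ChainComparison.IsErgodic P')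
    (hπ : ChainComparison.IsStationary P π) (hπ' : ChainComparison.IsStationary P' π)
    (f : ChainComparison.Flow P P' π)
    (x : Ω) (ε : ℝ) (hε : 0 < ε) (hεπ : ε ^ 2 * π x ≤ 1) :
    -- the mixing times below are infima of nonempty sets
    (ChainComparison.continuousMixingSet P π x ε).Nonempty ∧
    (∀ y, (ChainComparison.continuousMixingSet P' π y (1 / (2 * Real.exp 1))).Nonempty) ∧
    (∀ y, (ChainComparison.discreteMixingSet P' π y (1 / (2 * Real.exp 1))).Nonempty) ∧
    -- the two bounds
    ChainComparison.continuousMixingTimeFrom P π x ε ≤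
      4 * f.congestion π *
        (ChainComparison.continuousMixingTime P' π (1 / (2 * Real.exp 1)) ^ 2 /
          (1 / 2 - 1 / (2 * Real.exp 1)) ^ 2) *
        Real.log (1 / (ε ^ 2 * π x)) ∧
    ChainComparison.continuousMixingTimeFrom P π x ε ≤
      4 * f.congestion π *
        ((ChainComparison.discreteMixingTime P' π (1 / (2 * Real.exp 1)) : ℝ) ^ 2 /
          (1 / 2 - 1 / (2 * Real.exp 1)) ^ 2) *
        Real.log (1 / (ε ^ 2 * π x)) := by
  have hc := ChainComparison.half_sub_pos
  have hη0 : 0 < 1 / (2 * Real.exp 1) := by positivity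
  have hη : 1 / (2 * Real.exp 1) ≤ 1 / 2 := (sub_pos.1 hc).le
  have hne : ∀ y, (ChainComparison.continuousMixingSet P' π y (1 / (2 * Real.exp 1))).Nonempty := fun y => by
    refine ChainComparison.continuousMixingSet_nonempty hP' hπ' y hη0 ?_
    have h1 : π y ≤ 1 := by
      rw [← hπ.mem_stdSimplex.2]
      exact Finset.single_le_sum (fun i _ => hπ.mem_stdSimplex.1 i) (Finset.mem_univ y)
    nlinarith [hπ.mem_stdSimplex.1 y]
  exact ⟨ChainComparison.continuousMixingSet_nonempty hP hπ x hε hεπ, hne,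
    fun y => ChainComparison.discreteMixingSet_nonempty hP' hπ' y hη0,
    ChainComparison.continuousMixingTimeFrom_le_of_flow hP hP' hπ f hc
      (ChainComparison.piVariance_le_continuousMixingTime hP' hπ' hη hne) x hε hεπ,
    ChainComparison.continuousMixingTimeFrom_le_of_flow hP hP' hπ f hc
      (ChainComparison.piVariance_le_discreteMixingTime hP' hπ' hη0 hη) x hε hεπ⟩
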